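/- Conventions. A two-way nondeterministic finite automaton (2NFA) has a finite state set $Q$, an initial state, a set of final states and a transition function $\delta\colon Q\times(\Sigma\cup\{\triangleright,\triangleleft\})\to 2^{Q\times\{-1,+1\}}$. The input $w$ is written at positions $1,\dots,|w|$, between the endmarkers $\triangleright$ (position $0$) and $\triangleleft$ (position $|w|+1$), which the head cannot pass. The automaton accepts $w$ if some computation that starts in the initial state at position $1$ reaches a final state with the head on $\triangleleft$. It is a 2DFA if $|\delta(q,\sigma)|\le 1$ for all $q,\sigma$. A 2DFA with common-guess (2DFA+CG) over $\Sigma$ with finite annotation alphabet $\Gamma$ is a 2DFA over $\Sigma\times\Gamma$; it accepts $w\in\Sigma^*$ if the underlying 2DFA accepts some $v\in(\Sigma\times\Gamma)^*$ whose projection onto $\Sigma^*$ is $w$. A 1-limited automaton (1-LA) with finite work alphabet $\Delta\supseteq\Sigma$ is defined like a 2NFA, except that each move also rewrites the scanned cell: symbols of $\Sigma$ must be replaced with symbols of $\Delta\setminus\Sigma$, and symbols of $(\Delta\setminus\Sigma)\cup\{\triangleright,\triangleleft\}$ are left unchanged. It is deterministic if there is at most one transition for each state and scanned symbol. Theorem.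 For $n\in\mathbb N$ let $L_n=\{a^{2^n(n+1)}\}$, a language over the one-letter alphabet $\{a\}$. Then: 1. $L_n$ is recognized by a 2DFA+CG with $O(n)$ states and $3$ annotation symbols. 2. $L_n$ is recognized by a deterministic 1-LA with $O(n)$ states and $3$ work symbols. This holds under both ways of counting work symbols: there is such a machine with $|\Delta\setminus\{a\}|=3$, and there is such a machine with $|\Delta|=3$. 3. Every 2NFA that recognizes $L_n$ has at least $2^n(n+1)+1$ states. Here $O(n)$ is meant asymptotically as $n\to\infty$, with machines existing for every $n\in\mathbb N$. -/

import Mathlib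

open Filter Asymptotics

/-- The content of a tape cell: a symbol of the alphabet `α` or one of the two endmarkers. -/
inductive Cell (α : Type*) where
  | leftEnd : Cell α
  | letter (a : α) : Cell α
  | rightEnd : Cell α

/-- A head move: `-1` (backward) or `+1` (forward). -/
inductive Dir where
  | backward : Dir
  | forward : Dir

/-- The displacement of the head. -/
def Dir.toInt : Dir → ℤ
  | .backward => -1
  | .forward => 1

/-- The tape of an input word: the left endmarker at position `0`, the letters at positions
`1, …, |w|`, the right endmarker at position `|w| + 1` (later positions are never reached). -/
def initialTape {α : Type*} (w : List α) : ℕ → Cell α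
  | 0 => .leftEnd
  | i + 1 =>
    match w[i]? with
    | some a => .letter a
    | none => .rightEnd

/-- Two-way nondeterministic automata with input alphabet `α` and state set `Q`
(finiteness of `Q` is required where automata are used). -/
structure TwoNFA (α Q : Type*) where
  /-- the transition function -/
  step : Q → Cell α → Set (Q × Dir)
  /-- the initial state -/
  start : Q
  /-- the final states -/
  accept : Set Q

namespace TwoNFA

variable {α Q : Type*}

/-- One move on input `w`; a configuration is a state with a head position. The head stays between
the positions `0` and `|w| + 1` of the endmarkers. -/
def Move (A : TwoNFA α Q) (w : List α) (c c' : Q × ℕ) : Prop :=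
  ∃ d : Dir, (c'.1, d) ∈ A.step c.1 (initialTape w c.2) ∧
    (c'.2 : ℤ) = (c.2 : ℤ) + d.toInt ∧ c'.2 ≤ w.length + 1

/-- The accepted language: from the initial state at position `1`, some computation path
reaches a final state with the head on the right endmarker. -/
def language (A : TwoNFA α Q) : Language α :=
  {w | ∃ q ∈ A.accept, Relation.ReflTransGen (A.Move w) (A.start, 1) (q, w.length + 1)}

/-- At most one transition for each state and each tape symbol. -/
def IsDeterministic (A : TwoNFA α Q) : Prop :=
  ∀ (q : Q) (c : Cell α), (A.step q c).Subsingleton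

end TwoNFA

/-- Two-way automata with common-guess: input alphabet `α`, annotation alphabet `Γ` and
an underlying two-way automaton over the product alphabet. -/
structure TwoNFACG (α Γ Q : Type*) where
  /-- the underlying two-way automaton -/
  base : TwoNFA (α × Γ) Q

namespace TwoNFACG

variable {α Γ Q : Type*}

/-- The words that are the projection of some annotated word accepted by the underlying
automaton. -/
def language (M : TwoNFACG α Γ Q) : Language α :=
  {w | ∃ v ∈ M.base.language, v.map Prod.fst = w}

/-- The underlying automaton is deterministic (the annotation phase is not). -/
def IsDeterministic (M : TwoNFACG α Γ Q) : Prop :=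
  M.base.IsDeterministic

end TwoNFACG

/-- `1`-limited automata with input alphabet `α`, work alphabet `Δ` and state set `Q`. -/
structure OneLA (α Δ Q : Type*) where
  /-- the inclusion of the input alphabet in the work alphabet -/
  incl : α ↪ Δ
  /-- the transition function -/
  step : Q → Cell Δ → Set (Q × Cell Δ × Dir)
  /-- input symbols are always replaced with work symbols that are not input symbols -/
  rewrite_input : ∀ (q : Q) (a : α), ∀ t ∈ step q (.letter (incl a)),
    ∃ x : Δ, x ∉ Set.range incl ∧ t.2.1 = .letter x
  /-- all other symbols, the endmarkers included, are never changed -/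
  keep_other : ∀ (q : Q) (c : Cell Δ), (∀ a : α, c ≠ .letter (incl a)) →
    ∀ t ∈ step q c, t.2.1 = c
  /-- the initial state -/
  start : Q
  /-- the final states -/
  accept : Set Q

namespace OneLA

variable {α Δ Q : Type*}

/-- One move on a tape with right endmarker at position `n + 1`; a configuration is a state,
the tape content, and the head position. -/
def Move (A : OneLA α Δ Q) (n : ℕ) (c c' : Q × (ℕ → Cell Δ) × ℕ) : Prop :=
  ∃ (x : Cell Δ) (d : Dir), (c'.1, x, d) ∈ A.step c.1 (c.2.1 c.2.2) ∧
    c'.2.1 = Function.update c.2.1 c.2.2 x ∧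
    (c'.2.2 : ℤ) = (c.2.2 : ℤ) + d.toInt ∧ c'.2.2 ≤ n + 1

/-- The accepted language: from the initial state at position `1` of the tape holding the input,
some computation reaches a final state with the head on the right endmarker. -/
def language (A : OneLA α Δ Q) : Language α :=
  {w | ∃ q ∈ A.accept, ∃ tape : ℕ → Cell Δ,
    Relation.ReflTransGen (A.Move w.length)
      (A.start, initialTape (w.map A.incl), 1) (q, tape, w.length + 1)}

/-- At most one transition for each state and each tape symbol. -/
def IsDeterministic (A : OneLA α Δ Q) : Prop :=
  ∀ (q : Q) (c : Cell Δ), (A.step q c).Subsingleton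

end OneLA

/-- The singleton unary language `{a ^ (2 ^ n * (n + 1))}`, where the only letter `a` is `()`. -/
def unaryL (n : ℕ) : Language Unit :=
  {List.replicate (2 ^ n * (n + 1)) ()}

/-! The upper bounds come from a binary counter written along the input. Cut `2 ^ n * (n + 1)` cells
into `2 ^ n` blocks of `n + 1` cells; block `k` holds the `n` low bits of `k + 1`, least significant
first, then a separator. Each bit is determined by the bit `n + 1` cells earlier and the carry, so
one symbol, one carry and a distance of at most `n` suffice as memory: `O(n)` states. A carry
reaches a separator exactly at the end of block `2 ^ n - 1`, and the input is accepted iff it ends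
there. The common-guess automaton checks a guessed counter cell by cell (`CounterCG.accepts_stage`);
the 1-limited automaton writes the same counter, one new cell per round (`CounterLA.accepts_stage`).

The lower bound is a pumping argument. Suppose a 2NFA with at most `N` states accepts `a ^ N`, where
`N ≥ 1`. A traversal of the `N` letters has `N + 1` first-visit states, two of which coincide; the
loop between them has a length dividing `N!`, so it can be repeated until the traversal covers `N +
N!` letters (`FreePath.traverse`). Excursions returning to the same end need no pumping. Hence `a ^
(N + N!)` is accepted too, and `{a ^ N}` is not the language. -/

namespace TwoNFA

/-! ### Lower bound: pumping traversals of unary two-way automata -/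

variable {α Q : Type*}

/-- A move with the letter transitions `δ`, on the bi-infinite tape, from a position in `[a, b)`. -/
def FreeMove (δ : Q → Set (Q × Dir)) (a b : ℤ) (c c' : Q × ℤ) : Prop :=
  a ≤ c.2 ∧ c.2 < b ∧ ∃ d : Dir, (c'.1, d) ∈ δ c.1 ∧ c'.2 = c.2 + d.toInt

/-- Paths of free moves. -/
abbrev FreePath (δ : Q → Set (Q × Dir)) (a b : ℤ) : Q × ℤ → Q × ℤ → Prop :=
  Relation.ReflTransGen (FreeMove δ a b)

theorem toInt_mem (d : Dir) : d.toInt = -1 ∨ d.toInt = 1 := by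
  cases d <;> simp [Dir.toInt]

theorem FreePath.mono {δ : Q → Set (Q × Dir)} {a b a' b' : ℤ} (ha : a' ≤ a) (hb : b ≤ b')
    {c c' : Q × ℤ} (h : FreePath δ a b c c') : FreePath δ a' b' c c' :=
  Relation.ReflTransGen.mono (fun _ _ h => ⟨ha.trans h.1, h.2.1.trans_le hb, h.2.2⟩) _ _ h

theorem FreePath.shift {δ : Q → Set (Q × Dir)} {a b : ℤ} {c c' : Q × ℤ}
    (h : FreePath δ a b c c') (s : ℤ) :
    FreePath δ (a + s) (b + s) (c.1, c.2 + s) (c'.1, c'.2 + s) := by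
  refine Relation.ReflTransGen.lift (fun c : Q × ℤ => (c.1, c.2 + s)) ?_ _ _ h
  rintro x y ⟨h1, h2, d, hd, h3⟩
  exact ⟨by simpa using h1, by simpa using h2, d, hd, by simp only; omega⟩

/-- The reflected direction. -/
def _root_.Dir.reflect : Dir → Dir
  | .backward => .forward
  | .forward => .backward

theorem _root_.Dir.reflect_reflect (d : Dir) : d.reflect.reflect = d := by cases d <;> rfl

theorem _root_.Dir.toInt_reflect (d : Dir) : d.reflect.toInt = -d.toInt := by cases d <;> rfl

/-- The letter transitions with reflected directions. -/
def reflectStep (δ : Q → Set (Q × Dir)) (q : Q) : Set (Q × Dir) :=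
  {t | (t.1, t.2.reflect) ∈ δ q}

theorem reflectStep_reflectStep (δ : Q → Set (Q × Dir)) :
    reflectStep (reflectStep δ) = δ := by
  funext q
  ext t
  simp [reflectStep, Dir.reflect_reflect]

theorem FreePath.reflect {δ : Q → Set (Q × Dir)} {a b : ℤ} {c c' : Q × ℤ}
    (h : FreePath δ a b c c') (s : ℤ) :
    FreePath (reflectStep δ) (s - b + 1) (s - a + 1) (c.1, s - c.2) (c'.1, s - c'.2) := by
  refine Relation.ReflTransGen.lift (fun c : Q × ℤ => (c.1, s - c.2)) ?_ _ _ h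
  rintro x y ⟨h1, h2, d, hd, h3⟩
  refine ⟨by simp only; omega, by simp only; omega, d.reflect, ?_, ?_⟩
  · simpa [reflectStep, Dir.reflect_reflect] using hd
  · simp only [Dir.toInt_reflect]; omega

/-- Unit steps cannot jump over `b`. Cutting at the first visit keeps all earlier moves strictly
left of `b`, while the remaining path may still go back. -/
theorem FreePath.exists_hit {δ : Q → Set (Q × Dir)} {a b : ℤ} {c c' : Q × ℤ}
    (h : FreePath δ a (b + 1) c c') (hc : c.2 ≤ b) (hc' : b ≤ c'.2) :
    ∃ r, FreePath δ a b c (r, b) ∧ FreePath δ a (b + 1) (r, b) c' := by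
  induction h using Relation.ReflTransGen.head_induction_on with
  | refl =>
    obtain ⟨q, x⟩ := c'
    obtain rfl : x = b := le_antisymm hc hc'
    exact ⟨q, .refl, .refl⟩
  | @head c c₁ h₁ h₂ ih =>
    obtain ⟨q, x⟩ := c
    rcases hc.eq_or_lt with h | h
    · obtain rfl : x = b := h
      exact ⟨q, .refl, .head h₁ h₂⟩
    · obtain ⟨h3, h4, d, hd, h5⟩ := h₁
      have := toInt_mem d
      obtain ⟨r, hr, hr'⟩ := ih (by omega)
      exact ⟨r, .head ⟨h3, h, d, hd, h5⟩ hr, hr'⟩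

/-- The states in which a left-to-right traversal first visits each position. -/
theorem FreePath.exists_firstVisits {δ : Q → Set (Q × Dir)} {p : Q} (m : ℕ) (q : Q)
    (h : FreePath δ 1 (m + 1) (p, 1) (q, m + 1)) :
    ∃ f : ℕ → Q, f 0 = p ∧ f m = q ∧
      ∀ i < m, FreePath δ 1 (i + 2) (f i, i + 1) (f (i + 1), i + 2) := by
  induction m generalizing q with
  | zero =>
    rcases h.cases_head with h | ⟨c, ⟨h1, h2, -⟩, -⟩
    · simp only [Prod.mk.injEq] at h
      exact ⟨fun _ => p, rfl, h.1, by simp⟩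
    · simp at h1 h2
  | succ m ih =>
    push_cast at h
    obtain ⟨r, hr, hr'⟩ := h.exists_hit (by simp only; omega) (by simp only; omega)
    obtain ⟨f, hf0, hfm, hf⟩ := ih r hr
    refine ⟨fun i => if i ≤ m then f i else q, by simpa using hf0, by simp, fun i hi => ?_⟩
    rcases (Nat.lt_succ_iff.mp hi).eq_or_lt with rfl | him
    · simpa [hfm, add_assoc] using hr'
    · simpa [him.le, Nat.succ_le_of_lt him] using hf i him

/-- The loop may wander left of `x`, but its copies are shifted to the right, so they stay within
the letters at positions `≥ 1`. -/
theorem FreePath.pump {δ : Q → Set (Q × Dir)} {r : Q} {x y : ℤ} (hxy : x ≤ y)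
    (h : FreePath δ 1 y (r, x) (r, y)) (t : ℕ) :
    FreePath δ 1 (y + t * (y - x)) (r, x) (r, y + t * (y - x)) := by
  induction t with
  | zero => simpa using h
  | succ t ih =>
    have hn : 0 ≤ (t : ℤ) * (y - x) := mul_nonneg (by positivity) (by omega)
    have h2 := h.shift ((t + 1) * (y - x))
    have e : x + (t + 1) * (y - x) = y + t * (y - x) := by ring
    rw [e] at h2
    push_cast
    have e2 : ((t : ℤ) + 1) * (y - x) = t * (y - x) + (y - x) := by ring
    refine (ih.mono le_rfl ?_).trans (h2.mono ?_ le_rfl) <;> rw [e2] <;> omega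

/-- With at most `N` states, a left-to-right traversal of `N` letters gives one
of `N + N!` letters. -/
theorem FreePath.traverse [Fintype Q] {δ : Q → Set (Q × Dir)} {N : ℕ} (hQ : Fintype.card Q ≤ N)
    {p q : Q} (h : FreePath δ 1 (N + 1) (p, 1) (q, N + 1)) :
    FreePath δ 1 ((N + N.factorial : ℕ) + 1) (p, 1) (q, (N + N.factorial : ℕ) + 1) := by
  obtain ⟨f, rfl, rfl, hf⟩ := h.exists_firstVisits
  have hpath : ∀ i j, i ≤ j → j ≤ N → FreePath δ 1 (j + 1) (f i, i + 1) (f j, j + 1) := by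
    intro i j hij
    induction j, hij using Nat.le_induction with
    | base => exact fun _ => .refl
    | succ j hij ih =>
      intro hj
      have h2 := hf j hj
      push_cast
      rw [add_assoc (j : ℤ) 1 1]
      exact ((ih (by omega)).mono le_rfl (by omega)).trans h2
  obtain ⟨i, j, hij, hjN, heq⟩ : ∃ i j, i < j ∧ j ≤ N ∧ f i = f j := by
    obtain ⟨a, b, hab, he⟩ := Fintype.exists_ne_map_eq_of_card_lt
      (fun i : Fin (N + 1) => f i) (by simpa using Nat.lt_succ_of_le hQ)
    have hab' : (a : ℕ) ≠ b := fun h => hab (Fin.ext h)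
    rcases lt_or_gt_of_ne hab' with h | h
    · exact ⟨a, b, h, by omega, he⟩
    · exact ⟨b, a, h, by omega, he.symm⟩
  -- The number `t` of additional copies is chosen so that the loop lengths sum to `N!`, whatever
  -- loop the pigeonhole gave.
  obtain ⟨t, ht⟩ : j - i ∣ N.factorial := Nat.dvd_factorial (by omega) (by omega)
  have hmid := hpath i j hij.le hjN
  rw [heq] at hmid
  have hmid := hmid.pump (by omega) t
  have e : (t : ℤ) * ((j + 1 : ℤ) - (i + 1)) = N.factorial := by
    rw [ht]; push_cast [hij.le]; ring
  rw [e] at hmid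
  have h1 := hpath 0 i (by omega) (by omega)
  have h3 := (hpath j N hjN le_rfl).shift N.factorial
  rw [heq] at h1
  simp only [Nat.cast_zero, zero_add] at h1
  push_cast
  have e2 : (N : ℤ) + N.factorial + 1 = N + 1 + N.factorial := by ring
  rw [e2]
  refine ((h1.mono le_rfl ?_).trans (hmid.mono le_rfl ?_)).trans (h3.mono ?_ le_rfl) <;> omega

theorem FreePath.traverse_back [Fintype Q] {δ : Q → Set (Q × Dir)} {N : ℕ}
    (hQ : Fintype.card Q ≤ N) {p q : Q} (h : FreePath δ 1 (N + 1) (p, N) (q, 0)) :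
    FreePath δ 1 ((N + N.factorial : ℕ) + 1) (p, (N + N.factorial : ℕ)) (q, 0) := by
  -- Reflection at `N + 1` exchanges `0` with `N + 1` and `1` with `N`; the pumped path is then
  -- reflected at `N + N! + 1`.
  have h1 := h.reflect (N + 1)
  simp only [sub_self, zero_add, add_sub_cancel_left, sub_zero, add_sub_cancel_right] at h1
  have h2 := (h1.traverse hQ).reflect ((N + N.factorial : ℕ) + 1)
  simpa only [sub_self, zero_add, add_sub_cancel_left, sub_zero, add_sub_cancel_right,
    reflectStep_reflectStep] using h2

theorem _root_.initialTape_succ_of_lt {w : List α} {i : ℕ} (h : i < w.length) :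
    initialTape w (i + 1) = .letter w[i] := by
  simp [initialTape, h]

theorem _root_.initialTape_length_succ (w : List α) :
    initialTape w (w.length + 1) = .rightEnd := by
  simp [initialTape]

theorem move_of_freeMove (A : TwoNFA Unit Q) (m : ℕ) {c c' : Q × ℤ}
    (h : FreeMove (fun q => A.step q (.letter ())) 1 (m + 1) c c') :
    A.Move (List.replicate m ()) (c.1, c.2.toNat) (c'.1, c'.2.toNat) := by
  obtain ⟨h1, h2, d, hd, h3⟩ := h
  have := toInt_mem d
  refine ⟨d, ?_, by simp only; omega, by simp; omega⟩
  obtain ⟨i, hi⟩ : ∃ i : ℕ, c.2.toNat = i + 1 := ⟨c.2.toNat - 1, by omega⟩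
  simp only [hi]
  rw [initialTape_succ_of_lt (by simp; omega)]
  simpa using hd

theorem path_of_freePath (A : TwoNFA Unit Q) (m : ℕ) {c c' : Q × ℤ}
    (h : FreePath (fun q => A.step q (.letter ())) 1 (m + 1) c c') :
    Relation.ReflTransGen (A.Move (List.replicate m ())) (c.1, c.2.toNat) (c'.1, c'.2.toNat) :=
  Relation.ReflTransGen.lift (fun c : Q × ℤ => (c.1, c.2.toNat))
    (fun _ _ h => A.move_of_freeMove m h) _ _ h

/-- The computation is cut at its visits to the endmarkers. Each piece between them is a traversal,
which is pumped, or a return to the same end, which is copied (shifted by `N!` at the right end). -/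
theorem replicate_add_factorial_mem_language [Fintype Q] (A : TwoNFA Unit Q) {N : ℕ} (hN : 1 ≤ N)
    (hQ : Fintype.card Q ≤ N) (h : List.replicate N () ∈ A.language) :
    List.replicate (N + N.factorial) () ∈ A.language := by
  obtain ⟨q, hq, h⟩ := h
  refine ⟨q, hq, ?_⟩
  set δ : Q → Set (Q × Dir) := fun q => A.step q (.letter ()) with hδ
  set M := N + N.factorial with hM
  set R : Q × ℕ → Prop :=
    fun c => Relation.ReflTransGen (A.Move (List.replicate M ())) (A.start, 1) c with hR
  -- Configurations on the endmarkers are matched on the longer word. Inside the word, only the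
  -- entry point of the current piece is matched, since it is not yet known at which end the piece
  -- will leave.
  have key : ∀ c : Q × ℕ, Relation.ReflTransGen (A.Move (List.replicate N ())) (A.start, 1) c →
      (c.2 = 0 ∧ R (c.1, 0)) ∨ (c.2 = N + 1 ∧ R (c.1, M + 1)) ∨
      (1 ≤ c.2 ∧ c.2 ≤ N ∧
        ((∃ p, R (p, 1) ∧ FreePath δ 1 (N + 1) (p, 1) (c.1, c.2)) ∨
          (∃ p, R (p, M) ∧ FreePath δ 1 (N + 1) (p, N) (c.1, c.2)))) := by
    intro c hc
    induction hc with
    | refl => exact .inr (.inr ⟨le_rfl, hN, .inl ⟨_, .refl, .refl⟩⟩)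
    | @tail c c' _ hmove ih =>
      obtain ⟨s, x⟩ := c
      obtain ⟨s', x'⟩ := c'
      obtain ⟨d, hd, hx, hle⟩ := hmove
      have hdi := toInt_mem d
      simp only [List.length_replicate] at hd hx hle ih ⊢
      rcases ih with ⟨rfl, hr⟩ | ⟨rfl, hr⟩ | ⟨h1, h2, hp⟩
      · obtain rfl : x' = 1 := by omega
        refine .inr (.inr ⟨le_rfl, hN, .inl ⟨s', hr.tail ⟨d, hd, by simpa using hx, ?_⟩, .refl⟩⟩)
        simp
      · have hx' : x' = N := by omega
        have hdd : d.toInt = -1 := by omega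
        subst hx'
        refine .inr (.inr ⟨hN, le_rfl, .inr ⟨s', hr.tail ⟨d, ?_, ?_, ?_⟩, .refl⟩⟩)
        · have e1 := initialTape_length_succ (List.replicate x' ())
          have e2 := initialTape_length_succ (List.replicate M ())
          rw [List.length_replicate] at e1 e2
          simp only [e2]
          rwa [e1] at hd
        · simp only; omega
        · simp
      · have hd' : (s', d) ∈ δ s := by
          obtain ⟨i, rfl⟩ : ∃ i, x = i + 1 := ⟨x - 1, by omega⟩
          rw [initialTape_succ_of_lt (by simp; omega)] at hd
          simpa using hd
        have hfree : FreeMove δ 1 (N + 1) (s, (x : ℤ)) (s', (x' : ℤ)) :=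
          ⟨by simp only; omega, by simp only; omega, d, hd', hx⟩
        have hp' : (∃ p, R (p, 1) ∧ FreePath δ 1 (N + 1) (p, 1) (s', x')) ∨
            (∃ p, R (p, M) ∧ FreePath δ 1 (N + 1) (p, N) (s', x')) :=
          hp.imp (fun ⟨p, h, h'⟩ => ⟨p, h, h'.tail hfree⟩) (fun ⟨p, h, h'⟩ => ⟨p, h, h'.tail hfree⟩)
        have hto : ∀ {p y t z}, R (p, y) → FreePath δ 1 (M + 1) (p, (y : ℤ)) (t, (z : ℕ)) →
            R (t, z) := by
          intro p y t z h h'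
          have := A.path_of_freePath M h'
          exact h.trans (by simpa using this)
        by_cases hx0 : x' = 0
        · subst hx0
          refine .inl ⟨rfl, ?_⟩
          rcases hp' with ⟨p, h, h'⟩ | ⟨p, h, h'⟩
          · exact hto h (by simpa using h'.mono le_rfl (by omega))
          · exact hto h (by simpa [hM] using h'.traverse_back hQ)
        · by_cases hxN : x' = N + 1
          · subst hxN
            refine .inr (.inl ⟨rfl, ?_⟩)
            rcases hp' with ⟨p, h, h'⟩ | ⟨p, h, h'⟩
            · push_cast at h'
              exact hto h (by simpa [hM] using h'.traverse hQ)
            · refine hto h ?_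
              -- A return to the right end takes place on the last `N` letters of the longer word.
              have := h'.shift N.factorial
              refine FreePath.mono (a := 1 + N.factorial) (b := N + 1 + N.factorial)
                (by omega) (by omega) ?_
              convert this using 2 <;> push_cast [hM] <;> ring
          · exact .inr (.inr ⟨by omega, by omega, hp'⟩)
  simp only [List.length_replicate] at h ⊢
  rcases key _ h with ⟨h, -⟩ | ⟨-, h⟩ | ⟨-, h, -⟩
  · simp at h
  · exact h
  · simp at h

/-- A two-way automaton recognizing `{a ^ N}` has more than `N` states. -/
theorem lt_card_of_language_eq_singleton [Fintype Q] (A : TwoNFA Unit Q) {N : ℕ}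
    (h : A.language = {List.replicate N ()}) : N < Fintype.card Q := by
  rcases Nat.eq_zero_or_pos N with rfl | hN
  · exact Fintype.card_pos_iff.mpr ⟨A.start⟩
  by_contra hQ
  have h1 : List.replicate N () ∈ A.language := by rw [h]; rfl
  have h2 := A.replicate_add_factorial_mem_language hN (not_lt.mp hQ) h1
  rw [h] at h2
  have h3 := congrArg List.length (Set.mem_singleton_iff.mp h2)
  have := N.factorial_pos
  simp at h3
  omega

end TwoNFA

/-! ### Acceptance along forced moves -/

/-- Some path of `R` leads from `c` to `F`. -/
def CanReach {C : Type*} (R : C → C → Prop) (F : C → Prop) (c : C) : Prop :=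
  ∃ c', F c' ∧ Relation.ReflTransGen R c c'

section CanReach

variable {C : Type*} {R : C → C → Prop} {F : C → Prop} {c c' : C}

theorem canReach_of_final (h : F c) : CanReach R F c := ⟨c, h, .refl⟩

/-- A forced move changes nothing about acceptance, so a deterministic run can be followed by
equivalences that prove acceptance and rejection together. -/
theorem canReach_iff_of_unique (hF : ¬ F c) (h : R c c') (hu : ∀ d, R c d → d = c') :
    CanReach R F c ↔ CanReach R F c' := by
  constructor
  · rintro ⟨e, he, hp⟩
    rcases hp.cases_head with rfl | ⟨d, hd, hp⟩
    · exact absurd he hF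
    · exact ⟨e, he, hu d hd ▸ hp⟩
  · rintro ⟨e, he, hp⟩
    exact ⟨e, he, .head h hp⟩

theorem not_canReach_of_stuck (hF : ¬ F c) (h : ∀ d, ¬ R c d) : ¬ CanReach R F c := by
  rintro ⟨e, he, hp⟩
  rcases hp.cases_head with rfl | ⟨d, hd, hp⟩
  · exact hF he
  · exact h d hd

end CanReach

/-! ### The binary counter -/

namespace Counter

/-- The bit in cell `t` of the concatenated blocks of length `n + 1`: block `k` contains the
`n` low bits of `k + 1`, least significant first, and then a zero. -/
def bit (n t : ℕ) : Bool :=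
  decide (t % (n + 1) < n) && (t / (n + 1) + 1).testBit (t % (n + 1))

/-- The bit `n + 1` cells before cell `t`. -/
def prevBit (n t : ℕ) : Bool :=
  decide (t % (n + 1) < n) && (t / (n + 1)).testBit (t % (n + 1))

/-- The carry into cell `t` when the preceding block is incremented. -/
def carry (n t : ℕ) : Bool := decide (2 ^ (t % (n + 1)) ∣ t / (n + 1) + 1)

/-- `2 ^ i ∣ k + 1` says that the `i` low bits of `k` are all ones, that is, that adding `1` carries
into bit `i`. The induction halves `k`; for even `k` the carry dies at bit `0`. -/
theorem two_pow_succ_dvd_succ_iff (i k : ℕ) :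
    2 ^ (i + 1) ∣ k + 1 ↔ k.testBit i = true ∧ 2 ^ i ∣ k + 1 := by
  induction i generalizing k with
  | zero => simp [Nat.testBit_zero]; omega
  | succ i ih =>
    rw [Nat.testBit_succ]
    rcases Nat.even_or_odd' k with ⟨m, rfl | rfl⟩
    · have h : ∀ j, ¬ 2 ^ (j + 1) ∣ 2 * m + 1 := fun j hj => by
        have : 2 ∣ 2 * m + 1 := (Dvd.intro_left _ (pow_succ 2 j).symm).trans hj
        omega
      simp [h]
    · have h : ∀ j, 2 ^ (j + 1) ∣ 2 * m + 1 + 1 ↔ 2 ^ j ∣ m + 1 := fun j => by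
        rw [pow_succ', show 2 * m + 1 + 1 = 2 * (m + 1) by ring]
        exact Nat.mul_dvd_mul_iff_left (by omega)
      rw [h, h, ih, show (2 * m + 1) / 2 = m by omega]

theorem testBit_succ_eq (i k : ℕ) :
    (k + 1).testBit i = Bool.xor (k.testBit i) (decide (2 ^ i ∣ k + 1)) := by
  induction i generalizing k with
  | zero =>
    rw [Nat.testBit_zero, Nat.testBit_zero]
    rcases Nat.mod_two_eq_zero_or_one k with h | h <;> simp [h] <;> omega
  | succ i ih =>
    rw [Nat.testBit_succ, Nat.testBit_succ]
    rcases Nat.even_or_odd' k with ⟨m, rfl | rfl⟩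
    · have h : ¬ 2 ^ (i + 1) ∣ 2 * m + 1 := fun hj => by
        have : 2 ∣ 2 * m + 1 := (Dvd.intro_left _ (pow_succ 2 i).symm).trans hj
        omega
      simp only [h, decide_false, Bool.xor_false]
      congr 1; omega
    · have h : 2 ^ (i + 1) ∣ 2 * m + 1 + 1 ↔ 2 ^ i ∣ m + 1 := by
        rw [pow_succ', show 2 * m + 1 + 1 = 2 * (m + 1) by ring]
        exact Nat.mul_dvd_mul_iff_left (by omega)
      rw [show (2 * m + 1 + 1) / 2 = m + 1 by omega, show (2 * m + 1) / 2 = m by omega, ih]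
      simp only [h]

theorem succ_mod_of_lt {n t : ℕ} (h : t % (n + 1) < n) :
    (t + 1) % (n + 1) = t % (n + 1) + 1 := by
  rw [Nat.add_mod_eq_ite]
  split_ifs with h1 <;> rcases n with _ | n <;> simp_all [Nat.mod_eq_of_lt]; omega

theorem div_mul_add (n t : ℕ) : (n + 1) * (t / (n + 1)) + t % (n + 1) = t := Nat.div_add_mod _ _

theorem succ_div_of_lt {n t : ℕ} (h : t % (n + 1) < n) : (t + 1) / (n + 1) = t / (n + 1) := by
  rw [Nat.div_eq_iff (by omega)]
  have := div_mul_add n t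
  rw [mul_comm] at this
  omega

theorem succ_mod_of_not_lt {n t : ℕ} (h : ¬ t % (n + 1) < n) : (t + 1) % (n + 1) = 0 := by
  have := Nat.mod_lt t (by omega : 0 < n + 1)
  have h2 := div_mul_add n t
  have : t + 1 = (n + 1) * (t / (n + 1) + 1) := by
    rw [mul_add]; omega
  rw [this, Nat.mul_mod_right]

theorem bit_eq_xor {n t : ℕ} (h : t % (n + 1) < n) :
    bit n t = Bool.xor (prevBit n t) (carry n t) := by
  simp [bit, prevBit, carry, h, testBit_succ_eq]

theorem bit_eq_false {n t : ℕ} (h : ¬ t % (n + 1) < n) : bit n t = false := by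
  simp [bit, h]

theorem carry_succ {n t : ℕ} (h : t % (n + 1) < n) :
    carry n (t + 1) = (prevBit n t && carry n t) := by
  simp [prevBit, carry, h, succ_mod_of_lt h, succ_div_of_lt h, two_pow_succ_dvd_succ_iff]

theorem carry_succ_of_not_lt {n t : ℕ} (h : ¬ t % (n + 1) < n) : carry n (t + 1) = true := by
  simp [carry, succ_mod_of_not_lt h]

theorem prevBit_add (n t : ℕ) : prevBit n (t + (n + 1)) = bit n t := by
  simp [prevBit, bit]

/-- The first block is the increment of an imaginary block of zeros before the tape. -/
theorem prevBit_of_lt {n t : ℕ} (h : t < n + 1) : prevBit n t = false := by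
  simp [prevBit, Nat.div_eq_of_lt h]

/-- The separator of a block is reached with a carry exactly at the end of block `2 ^ n - 1`. -/
theorem carry_of_not_lt {n t : ℕ} (h : ¬ t % (n + 1) < n) (ht : t < 2 ^ n * (n + 1)) :
    carry n t = decide (t + 1 = 2 ^ n * (n + 1)) := by
  have h1 : t % (n + 1) = n := by have := Nat.mod_lt t (by omega : 0 < n + 1); omega
  have h2 := div_mul_add n t
  have h3 : t + 1 = (t / (n + 1) + 1) * (n + 1) := by
    rw [add_mul, mul_comm (t / (n + 1))]; omega
  have h4 : t / (n + 1) < 2 ^ n := Nat.div_lt_of_lt_mul (by rwa [mul_comm])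
  simp only [carry, h1, h3]
  rw [decide_eq_decide, Nat.mul_left_inj (by omega)]
  -- The block number plus one is positive and at most `2 ^ n`, so divisibility by `2 ^ n` forces
  -- equality.
  refine ⟨fun h => le_antisymm h4 (Nat.le_of_dvd (Nat.succ_pos _) h), fun h => by rw [h]⟩

theorem not_lt_of_succ_eq {n t : ℕ} (h : t + 1 = 2 ^ n * (n + 1)) : ¬ t % (n + 1) < n := by
  intro h1
  have := succ_mod_of_lt h1
  rw [h, Nat.mul_mod_left] at this
  omega

end Counter

/-! ### Runs of deterministic two-way automata -/

namespace TwoNFA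

variable {α Q : Type*}

/-- The deterministic automaton with a partial transition function. -/
def ofFun (f : Q → Cell α → Option (Q × Dir)) (start : Q) (accept : Set Q) : TwoNFA α Q where
  step q c := {t | f q c = some t}
  start := start
  accept := accept

theorem ofFun_isDeterministic (f : Q → Cell α → Option (Q × Dir)) (s : Q) (F : Set Q) :
    (ofFun f s F).IsDeterministic := fun _ _ _ hx _ hy => Option.some_injective _ (hx.symm.trans hy)

/-- From the configuration `c`, some computation on `w` accepts. -/
def Accepts (A : TwoNFA α Q) (w : List α) : Q × ℕ → Prop :=
  CanReach (A.Move w) fun c => c.1 ∈ A.accept ∧ c.2 = w.length + 1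

theorem mem_language_iff (A : TwoNFA α Q) (w : List α) :
    w ∈ A.language ↔ A.Accepts w (A.start, 1) := by
  constructor
  · rintro ⟨q, hq, h⟩
    exact ⟨_, ⟨hq, rfl⟩, h⟩
  · rintro ⟨⟨q, x⟩, ⟨hq, rfl⟩, h⟩
    exact ⟨q, hq, h⟩

variable {f : Q → Cell α → Option (Q × Dir)} {s : Q} {F : Set Q} {w : List α} {q q' : Q} {x : ℕ}

theorem accepts_final (hq : q ∈ F) (hx : x = w.length + 1) : (ofFun f s F).Accepts w (q, x) :=
  canReach_of_final ⟨hq, hx⟩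

theorem accepts_forward (hf : f q (initialTape w x) = some (q', .forward)) (hx : x ≤ w.length) :
    (ofFun f s F).Accepts w (q, x) ↔ (ofFun f s F).Accepts w (q', x + 1) := by
  refine canReach_iff_of_unique (fun h => ?_) ⟨.forward, hf, by simp [Dir.toInt], by simpa⟩ ?_
  · have := h.2
    simp only at this
    omega
  · rintro ⟨r, y⟩ ⟨d, hd, hy, -⟩
    obtain ⟨rfl, rfl⟩ : q' = r ∧ Dir.forward = d := by simpa using hf.symm.trans hd
    simp only [Dir.toInt] at hy
    rw [Prod.mk.injEq]
    exact ⟨rfl, by omega⟩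

theorem accepts_backward (hf : f q (initialTape w (x + 1)) = some (q', .backward))
    (hx : x < w.length) :
    (ofFun f s F).Accepts w (q, x + 1) ↔ (ofFun f s F).Accepts w (q', x) := by
  refine canReach_iff_of_unique (fun h => ?_)
    ⟨.backward, hf, by simp [Dir.toInt], by simp only; omega⟩ ?_
  · have := h.2
    simp only at this
    omega
  · rintro ⟨r, y⟩ ⟨d, hd, hy, -⟩
    obtain ⟨rfl, rfl⟩ : q' = r ∧ Dir.backward = d := by simpa using hf.symm.trans hd
    simp only [Dir.toInt] at hy
    rw [Prod.mk.injEq]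
    exact ⟨rfl, by push_cast at hy; omega⟩

theorem not_accepts_of_none (hf : f q (initialTape w x) = none) (h : q ∈ F → x ≠ w.length + 1) :
    ¬ (ofFun f s F).Accepts w (q, x) := by
  refine not_canReach_of_stuck (fun h' => h h'.1 h'.2) ?_
  rintro d ⟨e, he, -⟩
  simp [ofFun, hf] at he

end TwoNFA

/-! ### The two-way automaton checking the annotation

The annotation symbols are `none` (a separator) and `some b` (a bit of the counter). -/

namespace CounterCG

/-- The states: `check o` scans the first cell not checked yet, where `o` is the carry, or `none`
after a separator with an overflow; `back s c k` remembers the symbol `s` and the carry `c` while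
moving `k` more cells backward; `forth o k` moves forward over `k` more cells and one more. -/
inductive State (n : ℕ)
  | check (o : Option Bool)
  | back (s : Option Bool) (c : Bool) (k : Fin (n + 1))
  | forth (o : Option Bool) (k : Fin (n + 1))

/-- The states as a sum of products of finite types. -/
def stateEquiv (n : ℕ) : State n ≃
    Option Bool ⊕ (Option Bool × Bool × Fin (n + 1)) ⊕ (Option Bool × Fin (n + 1)) where
  toFun
    | .check o => .inl o
    | .back s c k => .inr (.inl (s, c, k))
    | .forth o k => .inr (.inr (o, k))
  invFun
    | .inl o => .check o
    | .inr (.inl (s, c, k)) => .back s c k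
    | .inr (.inr (o, k)) => .forth o k
  left_inv q := by cases q <;> rfl
  right_inv q := by rcases q with _ | _ | _ <;> rfl

instance (n : ℕ) : Fintype (State n) := .ofEquiv _ (stateEquiv n).symm

theorem card_state (n : ℕ) : Fintype.card (State n) = 9 * n + 12 := by
  rw [Fintype.card_congr (stateEquiv n)]
  simp
  ring

/-- Compares a symbol with the symbol `n + 1` cells before it and the carry; returns the
next carry. -/
def compare : Option Bool → Option Bool → Bool → Option (Option Bool)
  | none, none, c => some (if c then none else some true)
  | some b, some b', c => if b = Bool.xor b' c then some (some (b' && c)) else none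
  | _, _, _ => none

open State in
/-- The transition function. -/
def step (n : ℕ) : State n → Cell (Unit × Option Bool) → Option (State n × Dir)
  | check (some c), .letter (_, s) => some (back s c (Fin.last n), .backward)
  | back s c k, .letter (_, s') =>
    if k.val = 0 then (compare s s' c).map fun o => (forth o (Fin.last n), .forward)
    else some (back s c ⟨k.val - 1, by omega⟩, .backward)
  | back s c k, .leftEnd =>
    -- The left endmarker itself is the separator of the imaginary zero block; a walk that would go
    -- beyond it reads a zero. Having `k` moves left over means that the cell to be checked next is
    -- fewer steps away, whence `n - k`.
    (compare s (if k.val = 0 then none else some false) c).map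
      fun o => (forth o ⟨n - k.val, by omega⟩, .forward)
  | forth o k, .letter _ =>
    if k.val = 0 then some (check o, .forward) else some (forth o ⟨k.val - 1, by omega⟩, .forward)
  | _, _ => none

/-- The automaton. -/
abbrev machine (n : ℕ) : TwoNFA (Unit × Option Bool) (State n) :=
  .ofFun (step n) (.check (some true)) {.check none}

variable {n : ℕ} {v : List (Unit × Option Bool)}

theorem accepts_forth (o : Option Bool) (k : ℕ) (hk : k < n + 1) {x : ℕ} (hx : 1 ≤ x)
    (hxk : x + k ≤ v.length) :
    (machine n).Accepts v (.forth o ⟨k, hk⟩, x) ↔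
      (machine n).Accepts v (.check o, x + k + 1) := by
  induction k generalizing x with
  | zero =>
    obtain ⟨x, rfl⟩ := Nat.exists_eq_add_of_le' hx
    exact TwoNFA.accepts_forward (by simp [initialTape_succ_of_lt (w := v) (i := x) (by omega), step])
      (by omega)
  | succ k ih =>
    obtain ⟨x, rfl⟩ := Nat.exists_eq_add_of_le' hx
    refine (TwoNFA.accepts_forward (q' := .forth o ⟨k, by omega⟩)
      (by simp [initialTape_succ_of_lt (w := v) (i := x) (by omega), step])
      (by omega)).trans ?_
    refine (ih (by omega) (by omega) (by omega)).trans (iff_of_eq ?_)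
    congr 2; omega

theorem accepts_option_map {s : Option Bool} {s' : Option Bool} {c : Bool} {q : State n} {x : ℕ}
    {r : Option Bool → State n} (hx : x ≤ v.length) (P : Option Bool → Prop)
    (h : step n q (initialTape v x) = (compare s s' c).map fun o => (r o, .forward))
    (hP : ∀ o, (machine n).Accepts v (r o, x + 1) ↔ P o) :
    (machine n).Accepts v (q, x) ↔ ∃ o, compare s s' c = some o ∧ P o := by
  rcases hc : compare s s' c with _ | o
  · have : ¬ (machine n).Accepts v (q, x) :=
      TwoNFA.not_accepts_of_none (by rw [h, hc]; rfl) (fun _ => by omega)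
    simpa using this
  · rw [hc] at h
    simpa using (TwoNFA.accepts_forward h hx).trans (hP o)

/-- The symbol found `k` cells before position `x`, where the walk stops at the left endmarker. -/
def lookBack (v : List (Unit × Option Bool)) (x k : ℕ) : Option Bool :=
  if x < k then some false
  else match initialTape v (x - k) with
    | .letter a => a.2
    | _ => none

/-- The target `x + (n - k) + 2` is invariant along the backward walk, so the head always returns to
the cell after the checked one, even when the left endmarker cuts the walk short. -/
theorem accepts_back (s : Option Bool) (c : Bool) (k : ℕ) (hk : k < n + 1) {x : ℕ}
    (hx : x + (n - k) < v.length) :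
    (machine n).Accepts v (.back s c ⟨k, hk⟩, x) ↔
      ∃ o, compare s (lookBack v x k) c = some o ∧
        (machine n).Accepts v (.check o, x + (n - k) + 2) := by
  induction k generalizing x with
  | zero =>
    refine accepts_option_map (by omega) _ (r := fun o => .forth o ?_) ?_ ?_
    · exact Fin.last n
    · rcases x with _ | x
      · simp [step, lookBack, initialTape]; rfl
      · rw [initialTape_succ_of_lt (by omega)]
        simp [step, lookBack, initialTape_succ_of_lt (w := v) (i := x) (by omega)]
    · intro o
      refine (accepts_forth o n _ (by omega) (by omega)).trans (iff_of_eq ?_)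
      congr 2; omega
  | succ k ih =>
    rcases x with _ | x
    · refine accepts_option_map (by omega) _ (r := fun o => .forth o ?_) ?_ ?_
      · exact ⟨n - (k + 1), by omega⟩
      · simp [step, lookBack, initialTape]
      · intro o
        refine (accepts_forth o _ _ (by omega) (by omega)).trans (iff_of_eq ?_)
        congr 2; omega
    · refine (TwoNFA.accepts_backward (q' := .back s c ⟨k, by omega⟩)
        (by simp [initialTape_succ_of_lt (w := v) (i := x) (by omega), step]) (by omega)).trans ?_
      refine (ih (by omega) (by omega)).trans ?_
      have e : x + (n - k) + 2 = x + 1 + (n - (k + 1)) + 2 := by omega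
      have e2 : lookBack v (x + 1) (k + 1) = lookBack v x k := by
        simp [lookBack]
      rw [e, e2]

theorem accepts_check (c : Bool) {t : ℕ} (ht : t < v.length) :
    (machine n).Accepts v (.check (some c), t + 1) ↔
      ∃ o, compare v[t].2 (lookBack v t n) c = some o ∧
        (machine n).Accepts v (.check o, t + 2) := by
  refine (TwoNFA.accepts_backward (q' := .back v[t].2 c (Fin.last n))
    (by rw [initialTape_succ_of_lt ht]; rfl) ht).trans ?_
  have := accepts_back (v := v) (n := n) v[t].2 c n (by omega) (x := t) (by omega)
  simpa [Fin.last] using this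

/-- The symbol in cell `t` of the correct annotation. -/
def symbol (n t : ℕ) : Option Bool :=
  if t % (n + 1) < n then some (Counter.bit n t) else none

/-- For `t < n` the walk is cut short, for `t = n` it ends exactly on the endmarker, and for `t > n`
it reads an annotation already known to be correct. -/
theorem lookBack_eq {t : ℕ} (ht : t < v.length) (h : ∀ u (hu : u < t), v[u].2 = symbol n u) :
    lookBack v t n = if t % (n + 1) < n then some (Counter.prevBit n t) else none := by
  rcases lt_trichotomy t n with h1 | rfl | h1
  · simp [lookBack, h1, Nat.mod_eq_of_lt (h1.trans n.lt_succ_self),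
      Counter.prevBit_of_lt (h1.trans n.lt_succ_self)]
  · simp [lookBack, initialTape]
  · obtain ⟨u, rfl⟩ := Nat.exists_eq_add_of_le' h1
    have e : u + n.succ - n = u + 1 := by omega
    rw [lookBack, if_neg (by omega), e, initialTape_succ_of_lt (by omega)]
    simp only [h u (by omega), symbol, Nat.succ_eq_add_one, Counter.prevBit_add,
      Nat.add_mod_right]

/-- The state before checking cell `t`. -/
def stage (n t : ℕ) : State n :=
  if t = 2 ^ n * (n + 1) then .check none else .check (some (Counter.carry n t))

/-- Given a correct prefix, exactly one symbol passes the comparison. The automaton never counts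
positions modulo `n + 1`: separators are propagated from the endmarker by the comparison itself. -/
theorem accepts_stage {t : ℕ} (ht : t < v.length) (htn : t < 2 ^ n * (n + 1))
    (h : ∀ u (hu : u < t), v[u].2 = symbol n u) :
    (machine n).Accepts v (stage n t, t + 1) ↔
      v[t].2 = symbol n t ∧ (machine n).Accepts v (stage n (t + 1), t + 2) := by
  rw [stage, if_neg htn.ne, accepts_check _ ht, lookBack_eq ht h, symbol]
  by_cases hi : t % (n + 1) < n
  · have h1 : t + 1 ≠ 2 ^ n * (n + 1) := fun h => Counter.not_lt_of_succ_eq h hi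
    rw [if_pos hi, if_pos hi, stage, if_neg h1, Counter.carry_succ hi, Counter.bit_eq_xor hi]
    rcases v[t].2 with _ | b
    · simp [compare]
    · by_cases hb : b = Bool.xor (Counter.prevBit n t) (Counter.carry n t) <;> simp [compare, hb]
  · rw [if_neg hi, if_neg hi, stage, Counter.carry_succ_of_not_lt hi, Counter.carry_of_not_lt hi htn]
    rcases v[t].2 with _ | b
    · by_cases h1 : t + 1 = 2 ^ n * (n + 1) <;> simp [compare, h1]
    · simp [compare]

theorem mem_language_iff :
    v ∈ (machine n).language ↔ v.length = 2 ^ n * (n + 1) ∧ v.map Prod.snd =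
      (List.range (2 ^ n * (n + 1))).map (symbol n) := by
  have key : ∀ t ≤ v.length, t ≤ 2 ^ n * (n + 1) →
      (v ∈ (machine n).language ↔ (∀ u (hu : u < v.length), u < t → v[u].2 = symbol n u) ∧
        (machine n).Accepts v (stage n t, t + 1)) := by
    intro t
    induction t with
    | zero =>
      intro _ _
      rw [TwoNFA.mem_language_iff]
      simp [stage, Counter.carry, machine, TwoNFA.ofFun]
    | succ t ih =>
      intro h1 h2
      refine (ih (by omega) (by omega)).trans ?_
      constructor
      · rintro ⟨h3, h4⟩
        obtain ⟨h5, h6⟩ :=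
          (accepts_stage h1 h2 fun u hu => h3 u (by omega) hu).mp h4
        refine ⟨fun u hu hut => ?_, h6⟩
        rcases (Nat.lt_succ_iff.mp hut).eq_or_lt with rfl | h
        · exact h5
        · exact h3 u hu h
      · rintro ⟨h3, h4⟩
        have h5 : ∀ u (hu : u < v.length), u < t → v[u].2 = symbol n u :=
          fun u hu hut => h3 u hu (by omega)
        exact ⟨h5, (accepts_stage h1 h2 fun u hu => h5 u (by omega) hu).mpr
          ⟨h3 t h1 (by omega), h4⟩⟩
  -- A word that is too short leaves the automaton stuck on the right endmarker before overflow; one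
  -- that is too long leaves `check none` stuck on a letter.
  have hend : ∀ q, step n q .rightEnd = none := by
    rintro ((_ | _) | _ | _) <;> rfl
  rcases lt_trichotomy v.length (2 ^ n * (n + 1)) with h | h | h
  · rw [key v.length le_rfl h.le, stage, if_neg h.ne]
    have : ¬ (machine n).Accepts v (.check (some (Counter.carry n v.length)), v.length + 1) :=
      TwoNFA.not_accepts_of_none (by rw [initialTape_length_succ]; exact hend _) (by simp)
    simp [this, h.ne]
  · rw [key _ h.ge le_rfl, stage, if_pos rfl]
    have : (machine n).Accepts v (.check none, 2 ^ n * (n + 1) + 1) :=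
      TwoNFA.accepts_final rfl (by rw [h])
    simp only [this, and_true, h, true_and]
    constructor
    · intro h1
      refine List.ext_getElem (by simpa) fun u hu _ => ?_
      simp only [List.length_map] at hu
      simpa using h1 u (by omega) (by omega)
    · intro h1 u hu _
      have := List.getElem_of_eq h1 (i := u) (by simpa [h] using hu)
      simpa using this
  · rw [key _ h.le le_rfl, stage, if_pos rfl]
    have : ¬ (machine n).Accepts v (.check none, 2 ^ n * (n + 1) + 1) :=
      TwoNFA.not_accepts_of_none (by rw [initialTape_succ_of_lt h]; rfl) (by omega)
    simp [this, h.ne']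

theorem language_eq : (TwoNFACG.mk (machine n)).language = unaryL n := by
  ext w
  constructor
  · rintro ⟨v, hv, rfl⟩
    refine List.eq_replicate_iff.mpr ⟨?_, by simp⟩
    simpa using (mem_language_iff.mp hv).1
  · intro hw
    obtain rfl : w = _ := hw
    refine ⟨(List.range (2 ^ n * (n + 1))).map fun t => ((), symbol n t), ?_, ?_⟩
    · exact mem_language_iff.mpr ⟨by simp, by simp⟩
    · simp [Function.comp_def]

end CounterCG

/-! ### Runs of deterministic 1-limited automata -/

namespace OneLA

variable {α Δ Q : Type*}

/-- From the configuration `c`, some computation on an input of length `m` accepts. -/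
def Accepts (A : OneLA α Δ Q) (m : ℕ) : Q × (ℕ → Cell Δ) × ℕ → Prop :=
  CanReach (A.Move m) fun c => c.1 ∈ A.accept ∧ c.2.2 = m + 1

theorem mem_language_iff (A : OneLA α Δ Q) (w : List α) :
    w ∈ A.language ↔ A.Accepts w.length (A.start, initialTape (w.map A.incl), 1) := by
  constructor
  · rintro ⟨q, hq, T, h⟩
    exact ⟨_, ⟨hq, rfl⟩, h⟩
  · rintro ⟨⟨q, T, x⟩, ⟨hq, rfl⟩, h⟩
    exact ⟨q, hq, T, h⟩

variable {A : OneLA α Δ Q} {m : ℕ} {q q' : Q} {T : ℕ → Cell Δ} {c : Cell Δ} {x : ℕ}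

theorem accepts_final (hq : q ∈ A.accept) (hx : x = m + 1) : A.Accepts m (q, T, x) :=
  canReach_of_final ⟨hq, hx⟩

theorem accepts_write_forward (hA : A.IsDeterministic)
    (hf : (q', c, Dir.forward) ∈ A.step q (T x)) (hx : x ≤ m) :
    A.Accepts m (q, T, x) ↔ A.Accepts m (q', Function.update T x c, x + 1) := by
  refine canReach_iff_of_unique (fun h => ?_)
    ⟨c, .forward, hf, rfl, by simp [Dir.toInt], by simpa⟩ ?_
  · have := h.2
    simp only at this
    omega
  · rintro ⟨r, U, y⟩ ⟨e, d, hd, hU, hy, -⟩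
    obtain ⟨rfl, rfl, rfl⟩ : r = q' ∧ e = c ∧ d = Dir.forward := by simpa using hA _ _ hd hf
    simp only [Dir.toInt] at hy hU
    rw [Prod.mk.injEq, Prod.mk.injEq]
    exact ⟨rfl, hU, by omega⟩

theorem accepts_write_backward (hA : A.IsDeterministic)
    (hf : (q', c, Dir.backward) ∈ A.step q (T (x + 1))) (hx : x < m) :
    A.Accepts m (q, T, x + 1) ↔ A.Accepts m (q', Function.update T (x + 1) c, x) := by
  refine canReach_iff_of_unique (fun h => ?_)
    ⟨c, .backward, hf, rfl, by simp [Dir.toInt], by simp only; omega⟩ ?_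
  · have := h.2
    simp only at this
    omega
  · rintro ⟨r, U, y⟩ ⟨e, d, hd, hU, hy, -⟩
    obtain ⟨rfl, rfl, rfl⟩ : r = q' ∧ e = c ∧ d = Dir.backward := by simpa using hA _ _ hd hf
    simp only [Dir.toInt] at hy hU
    rw [Prod.mk.injEq, Prod.mk.injEq]
    exact ⟨rfl, hU, by push_cast at hy; omega⟩

theorem accepts_forward (hA : A.IsDeterministic)
    (hf : (q', T x, Dir.forward) ∈ A.step q (T x)) (hx : x ≤ m) :
    A.Accepts m (q, T, x) ↔ A.Accepts m (q', T, x + 1) := by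
  simpa only [Function.update_eq_self] using accepts_write_forward hA hf hx

theorem accepts_backward (hA : A.IsDeterministic)
    (hf : (q', T (x + 1), Dir.backward) ∈ A.step q (T (x + 1))) (hx : x < m) :
    A.Accepts m (q, T, x + 1) ↔ A.Accepts m (q', T, x) := by
  simpa only [Function.update_eq_self] using accepts_write_backward hA hf hx

theorem not_accepts_of_stuck (hf : A.step q (T x) = ∅) (h : q ∈ A.accept → x ≠ m + 1) :
    ¬ A.Accepts m (q, T, x) := by
  refine not_canReach_of_stuck (fun h' => h h'.1 h'.2) ?_
  rintro d ⟨c, e, he, -⟩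
  simp [hf] at he

end OneLA

/-! ### The one-limited automaton writing the binary counter -/

namespace CounterLA

/-- The states. `right c y i` moves forward to the first cell not visited yet, counting the
position modulo `n + 1` in `i`; there `c` is the carry and `y` the bit `n + 1` cells before.
`back c k` moves backward over `k` more cells to read the next such bit; `left c y` then moves on to
the left endmarker. In `done`, the counter has overflowed. -/
inductive State (n : ℕ)
  | right (c y : Bool) (i : Fin (n + 1))
  | back (c : Bool) (k : Fin (n + 1))
  | left (c y : Bool)
  | done

/-- The states as a sum of products of finite types. -/
def stateEquiv (n : ℕ) : State n ≃
    (Bool × Bool × Fin (n + 1)) ⊕ (Bool × Fin (n + 1)) ⊕ (Bool × Bool) ⊕ Unit where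
  toFun
    | .right c y i => .inl (c, y, i)
    | .back c k => .inr (.inl (c, k))
    | .left c y => .inr (.inr (.inl (c, y)))
    | .done => .inr (.inr (.inr ()))
  invFun
    | .inl (c, y, i) => .right c y i
    | .inr (.inl (c, k)) => .back c k
    | .inr (.inr (.inl (c, y))) => .left c y
    | .inr (.inr (.inr ())) => .done
  left_inv q := by cases q <;> rfl
  right_inv q := by rcases q with _ | _ | _ | _ <;> rfl

instance (n : ℕ) : Fintype (State n) := .ofEquiv _ (stateEquiv n).symm

theorem card_state (n : ℕ) : Fintype.card (State n) = 6 * n + 11 := by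
  rw [Fintype.card_congr (stateEquiv n)]
  simp
  ring

variable {E : Type*}

open State in
/-- The transition function; the tape symbol `none` is the input letter, `enc b` is the symbol
written for the bit `b`, and `dec` reads it. -/
def next (n : ℕ) (enc : Bool → E) (dec : E → Bool) :
    State n → Cell (Option E) → Option (State n × Cell (Option E) × Dir)
  | right c y i, .letter none =>
    if i.val < n then
      some (back (y && c) ⟨n - 1, by omega⟩, .letter (some (enc (Bool.xor y c))), .backward)
    else if c then some (done, .letter (some (enc false)), .forward)
    else some (back true ⟨n - 1, by omega⟩, .letter (some (enc false)), .backward)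
  | right c y i, .letter (some e) =>
    if h : i.val < n then some (right c y ⟨i.val + 1, by omega⟩, .letter (some e), .forward)
    else some (right c y 0, .letter (some e), .forward)
  | back c k, .letter (some e) =>
    if k.val = 0 then some (left c (dec e), .letter (some e), .backward)
    else some (back c ⟨k.val - 1, by omega⟩, .letter (some e), .backward)
  | back c _, .leftEnd => some (right c false 0, .leftEnd, .forward)
  | left c y, .letter (some e) => some (left c y, .letter (some e), .backward)
  | left c y, .leftEnd => some (right c y 0, .leftEnd, .forward)
  | _, _ => none

/-- The automaton. -/
def machine (n : ℕ) (enc : Bool → E) (dec : E → Bool) : OneLA Unit (Option E) (State n) where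
  incl := ⟨fun _ => none, fun _ _ _ => rfl⟩
  step q c := {t | next n enc dec q c = some t}
  rewrite_input := by
    rintro q a ⟨q', c, d⟩ ht
    replace ht : next n enc dec q (.letter none) = some (q', c, d) := ht
    suffices ∃ e, c = .letter (some e) by
      obtain ⟨e, rfl⟩ := this
      exact ⟨some e, by simp, rfl⟩
    rcases q with ⟨c', y, i⟩ | _ | _ | _
    · simp only [next] at ht
      split_ifs at ht <;> simp only [Option.some.injEq, Prod.mk.injEq] at ht <;>
        exact ⟨_, ht.2.1.symm⟩
    all_goals simp [next] at ht
  keep_other := by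
    rintro q c hc ⟨q', c', d⟩ ht
    replace ht : next n enc dec q c = some (q', c', d) := ht
    rcases c with _ | (_ | e) | _
    · rcases q with _ | _ | _ | _ <;> simp_all [next]
    · exact absurd rfl (hc ())
    · rcases q with _ | _ | _ | _ <;> simp only [next] at ht <;> (try split_ifs at ht) <;>
        simp_all
    · rcases q with _ | _ | _ | _ <;> simp_all [next]
  start := .right true false 0
  accept := {.done}

theorem isDeterministic (n : ℕ) (enc : Bool → E) (dec : E → Bool) :
    (machine n enc dec).IsDeterministic :=
  fun _ _ _ hx _ hy => Option.some_injective _ (hx.symm.trans hy)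

/-- The tape over an input of length `m` after the first `t` cells have been rewritten. -/
def tape (n : ℕ) (enc : Bool → E) (m t : ℕ) : ℕ → Cell (Option E)
  | 0 => .leftEnd
  | p + 1 =>
    if p < t then .letter (some (enc (Counter.bit n p)))
    else if p < m then .letter none else .rightEnd

variable {n m t : ℕ} {enc : Bool → E} {dec : E → Bool}

theorem tape_zero : tape n enc m 0 = initialTape (List.replicate m none) := by
  funext p
  rcases p with _ | p
  · rfl
  · by_cases h : p < m <;> simp [tape, initialTape, h]

theorem update_tape (ht : t < m) :
    Function.update (tape n enc m t) (t + 1) (.letter (some (enc (Counter.bit n t)))) =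
      tape n enc m (t + 1) := by
  funext p
  rcases p with _ | p
  · simp [tape]
  · rcases lt_trichotomy p t with h | rfl | h
    · simp [tape, h, h.ne, h.trans t.lt_succ_self]
    · simp [tape]
    · simp [tape, h.ne', not_lt.mpr h.le, not_lt.mpr (Nat.succ_le_of_lt h)]

theorem tape_of_lt {p : ℕ} (h : p < t) :
    tape n enc m t (p + 1) = .letter (some (enc (Counter.bit n p))) := by
  simp [tape, h]

theorem tape_frontier (h : t < m) : tape n enc m t (t + 1) = .letter none := by
  simp [tape, h]

theorem tape_end : tape n enc m m (m + 1) = .rightEnd := by simp [tape]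

theorem accepts_left {c y : Bool} {x : ℕ} (hx : x ≤ t) (ht : t ≤ m) :
    (machine n enc dec).Accepts m (.left c y, tape n enc m t, x) ↔
      (machine n enc dec).Accepts m (.right c y 0, tape n enc m t, 1) := by
  induction x with
  | zero => exact OneLA.accepts_forward (isDeterministic _ _ _) rfl (by omega)
  | succ x ih =>
    refine (OneLA.accepts_backward (isDeterministic _ _ _) (q' := .left c y) ?_ (by omega)).trans
      (ih (by omega))
    rw [tape_of_lt hx]
    rfl

theorem accepts_back (hdec : ∀ b, dec (enc b) = b) {c : Bool} {k : ℕ} (hk : k < n + 1) {x : ℕ}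
    (hx : x ≤ t) (ht : t ≤ m) :
    (machine n enc dec).Accepts m (.back c ⟨k, hk⟩, tape n enc m t, x) ↔
      (machine n enc dec).Accepts m
        (.right c (decide (k < x) && Counter.bit n (x - k - 1)) 0, tape n enc m t, 1) := by
  induction k generalizing x with
  | zero =>
    rcases x with _ | x
    · exact OneLA.accepts_forward (isDeterministic _ _ _) rfl (by omega)
    · refine (OneLA.accepts_backward (isDeterministic _ _ _) (q' := .left c (Counter.bit n x))
        ?_ (by omega)).trans ((accepts_left (by omega) ht).trans ?_)
      · rw [tape_of_lt hx]
        simp [machine, next, hdec]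
      · simp
  | succ k ih =>
    rcases x with _ | x
    · exact OneLA.accepts_forward (isDeterministic _ _ _) rfl (by omega)
    · refine (OneLA.accepts_backward (isDeterministic _ _ _) (q' := .back c ⟨k, by omega⟩)
        ?_ (by omega)).trans ((ih (by omega) (by omega)).trans ?_)
      · rw [tape_of_lt hx]
        simp [machine, next]
      · simp

/-- Every round restarts at the left endmarker, so that the position modulo `n + 1` is recounted;
separators are written as ordinary zeros and cannot be recognized by their symbol. -/
theorem accepts_right {c y : Bool} (ht : t ≤ m) :
    (machine n enc dec).Accepts m (.right c y 0, tape n enc m t, 1) ↔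
      (machine n enc dec).Accepts m
        (.right c y ⟨t % (n + 1), Nat.mod_lt _ n.succ_pos⟩, tape n enc m t, t + 1) := by
  suffices ∀ p ≤ t, ((machine n enc dec).Accepts m (.right c y 0, tape n enc m t, 1) ↔
      (machine n enc dec).Accepts m
        (.right c y ⟨p % (n + 1), Nat.mod_lt _ n.succ_pos⟩, tape n enc m t, p + 1)) from
    this t le_rfl
  intro p
  induction p with
  | zero => intro _; simp
  | succ p ih =>
    intro hp
    refine (ih (by omega)).trans (OneLA.accepts_forward (isDeterministic _ _ _) ?_ (by omega))
    rw [tape_of_lt hp]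
    by_cases h : p % (n + 1) < n
    · simp [machine, next, h, Counter.succ_mod_of_lt h]
    · simp [machine, next, h, Counter.succ_mod_of_not_lt h]

/-- The state in which cell `t` is reached for the first time. -/
def stage (n t : ℕ) : State n :=
  if t = 2 ^ n * (n + 1) then .done
  else .right (Counter.carry n t) (Counter.prevBit n t) ⟨t % (n + 1), Nat.mod_lt _ n.succ_pos⟩

/-- After writing cell `t`, the head is one position to its left; `n - 1` further moves put it `n +
1` cells before the next cell `t + 1`. For `n = 0` the truncated `n - 1` would be wrong. -/
theorem accepts_back_stage (hdec : ∀ b, dec (enc b) = b) (hn : 1 ≤ n)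
    (ht : t < m) (htn : t + 1 ≠ 2 ^ n * (n + 1)) :
    (machine n enc dec).Accepts m
        (.back (Counter.carry n (t + 1)) ⟨n - 1, by omega⟩, tape n enc m (t + 1), t) ↔
      (machine n enc dec).Accepts m (stage n (t + 1), tape n enc m (t + 1), t + 2) := by
  rw [accepts_back hdec _ (by omega) (by omega), accepts_right (by omega), stage, if_neg htn]
  suffices (decide (n - 1 < t) && Counter.bit n (t - (n - 1) - 1)) = Counter.prevBit n (t + 1) by
    rw [this]
  by_cases h : n - 1 < t
  · obtain ⟨u, rfl⟩ := Nat.exists_eq_add_of_le (show n ≤ t by omega)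
    have e : n + u + 1 = u + (n + 1) := by ring
    have e2 : n + u - (n - 1) - 1 = u := by omega
    rw [e, Counter.prevBit_add, e2]
    simp [h]
  · rw [Counter.prevBit_of_lt (by omega)]
    simp [h]

theorem accepts_stage (hdec : ∀ b, dec (enc b) = b) (ht : t < m) (htn : t < 2 ^ n * (n + 1)) :
    (machine n enc dec).Accepts m (stage n t, tape n enc m t, t + 1) ↔
      (machine n enc dec).Accepts m (stage n (t + 1), tape n enc m (t + 1), t + 2) := by
  rw [stage, if_neg htn.ne]
  by_cases hi : t % (n + 1) < n
  · have h1 : t + 1 ≠ 2 ^ n * (n + 1) := fun h => Counter.not_lt_of_succ_eq h hi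
    rw [← accepts_back_stage hdec (by omega) ht h1, ← update_tape ht]
    refine OneLA.accepts_write_backward (isDeterministic _ _ _) ?_ ht
    rw [tape_frontier ht]
    simp [machine, next, hi, Counter.carry_succ hi, Counter.bit_eq_xor hi]
  · by_cases h1 : t + 1 = 2 ^ n * (n + 1)
    · rw [← update_tape ht, stage, if_pos h1]
      refine OneLA.accepts_write_forward (isDeterministic _ _ _) ?_ ht
      rw [tape_frontier ht]
      simp [machine, next, hi, Counter.carry_of_not_lt hi htn, h1, Counter.bit_eq_false hi]
    -- For `n = 0` the counter overflows at its only cell, so no further round is needed.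
    · have hn : 1 ≤ n := by
        by_contra hn
        obtain rfl : n = 0 := by omega
        simp at htn h1
        omega
      rw [← accepts_back_stage hdec hn ht h1, ← update_tape ht]
      refine OneLA.accepts_write_backward (isDeterministic _ _ _) ?_ ht
      rw [tape_frontier ht]
      simp [machine, next, hi, Counter.carry_of_not_lt hi htn, h1, Counter.bit_eq_false hi,
        Counter.carry_succ_of_not_lt hi]

theorem language_eq (hdec : ∀ b, dec (enc b) = b) :
    (machine n enc dec).language = unaryL n := by
  ext w
  obtain ⟨m, rfl⟩ : ∃ m, w = List.replicate m () := ⟨w.length, List.eq_replicate_length.mpr (by simp)⟩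
  have key : ∀ t ≤ m, t ≤ 2 ^ n * (n + 1) →
      (List.replicate m () ∈ (machine n enc dec).language ↔
        (machine n enc dec).Accepts m (stage n t, tape n enc m t, t + 1)) := by
    intro t
    induction t with
    | zero =>
      intro _ _
      rw [OneLA.mem_language_iff]
      simp [stage, Counter.carry, Counter.prevBit, tape_zero, machine]
      rfl
    | succ t ih => exact fun h1 h2 => (ih (by omega) (by omega)).trans (accepts_stage hdec h1 h2)
  have hmem : List.replicate m () ∈ unaryL n ↔ m = 2 ^ n * (n + 1) :=
    List.replicate_left_inj
  rw [hmem]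
  rcases lt_trichotomy m (2 ^ n * (n + 1)) with h | h | h
  · rw [key m le_rfl h.le, stage, if_neg h.ne]
    refine iff_of_false (OneLA.not_accepts_of_stuck ?_ ?_) h.ne
    · simp [machine, tape_end, next]
    · simp [machine]
  · rw [key _ h.ge le_rfl, stage, if_pos rfl]
    exact iff_of_true (OneLA.accepts_final rfl (by rw [h])) h
  · rw [key _ h.le le_rfl, stage, if_pos rfl]
    refine iff_of_false (OneLA.not_accepts_of_stuck ?_ (by omega)) h.ne'
    rw [tape_frontier h]
    simp [machine, next]

end CounterLA

/-! ### State counts and the final assembly -/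

theorem isBigO_natCast_affine (a b : ℕ) :
    (fun n : ℕ => ((a * n + b : ℕ) : ℝ)) =O[atTop] (fun n : ℕ => (n : ℝ)) := by
  refine IsBigO.of_bound (a + b) ?_
  filter_upwards [eventually_ge_atTop 1] with n hn
  have h : (1 : ℝ) ≤ n := by exact_mod_cast hn
  rw [Real.norm_natCast, Real.norm_natCast]
  push_cast
  nlinarith [(Nat.cast_nonneg b : (0 : ℝ) ≤ b)]

theorem mainTheorem3 :
    -- a 2DFA with common-guess, `O(n)` states and 3 annotation symbols
    (∃ s : ℕ → ℕ, (fun n => (s n : ℝ)) =O[atTop] (fun n => (n : ℝ)) ∧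
      ∀ n : ℕ, ∃ (Q Γ : Type) (_ : Fintype Q) (_ : Fintype Γ) (M : TwoNFACG Unit Γ Q),
        Fintype.card Q = s n ∧ Fintype.card Γ = 3 ∧
        M.IsDeterministic ∧ M.language = unaryL n) ∧
    -- a deterministic 1-LA, `O(n)` states and 3 work symbols besides the input letter
    (∃ s : ℕ → ℕ, (fun n => (s n : ℝ)) =O[atTop] (fun n => (n : ℝ)) ∧
      ∀ n : ℕ, ∃ (Q Δ : Type) (_ : Fintype Q) (_ : Fintype Δ) (A : OneLA Unit Δ Q),
        Fintype.card Q = s n ∧ (Set.range A.incl)ᶜ.ncard = 3 ∧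
        A.IsDeterministic ∧ A.language = unaryL n) ∧
    -- a deterministic 1-LA, `O(n)` states and 3 work symbols including the input letter
    (∃ s : ℕ → ℕ, (fun n => (s n : ℝ)) =O[atTop] (fun n => (n : ℝ)) ∧
      ∀ n : ℕ, ∃ (Q Δ : Type) (_ : Fintype Q) (_ : Fintype Δ) (A : OneLA Unit Δ Q),
        Fintype.card Q = s n ∧ Fintype.card Δ = 3 ∧
        A.IsDeterministic ∧ A.language = unaryL n) ∧
    -- every 2NFA has at least `2 ^ n * (n + 1) + 1` states
    (∀ (n : ℕ) (Q : Type*) [Fintype Q] (A : TwoNFA Unit Q),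
      A.language = unaryL n → 2 ^ n * (n + 1) + 1 ≤ Fintype.card Q) := by
  refine ⟨⟨fun n => 9 * n + 12, isBigO_natCast_affine 9 12, fun n => ?_⟩,
    ⟨fun n => 6 * n + 11, isBigO_natCast_affine 6 11, fun n => ?_⟩,
    ⟨fun n => 6 * n + 11, isBigO_natCast_affine 6 11, fun n => ?_⟩, fun n Q _ A h => ?_⟩
  · exact ⟨CounterCG.State n, Option Bool, inferInstance, inferInstance,
      ⟨CounterCG.machine n⟩, CounterCG.card_state n, by simp,
      TwoNFA.ofFun_isDeterministic _ _ _, CounterCG.language_eq⟩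
  -- Two written symbols suffice. Here a third one, never written, pads the count to `3`; in the
  -- next case the input letter is the third symbol.
  · refine ⟨CounterLA.State n, Option (Option Bool), inferInstance, inferInstance,
      CounterLA.machine n some (fun e => e.getD false), CounterLA.card_state n, ?_,
      CounterLA.isDeterministic _ _ _, CounterLA.language_eq fun _ => rfl⟩
    have hr : Set.range (CounterLA.machine n (some : Bool → Option Bool)
        (fun e => e.getD false)).incl = {none} := Set.range_const
    rw [hr, Set.ncard_compl]
    simp
  · exact ⟨CounterLA.State n, Option Bool, inferInstance, inferInstance,
      CounterLA.machine n id id, CounterLA.card_state n, by simp,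
      CounterLA.isDeterministic _ _ _, CounterLA.language_eq fun _ => rfl⟩
  · exact A.lt_card_of_language_eq_singleton h
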